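/- Let $R$ be a finite commutative ring with identity, with Artin decomposition $R \cong R_1 \times \cdots \times R_s$ into $s \ge 1$ local rings, where $s$ is even. Let $G_R = X(R, R^*)$ be its unitary Cayley graph, that is, the graph with vertex set $R$ in which $x$ and $y$ are adjacent if and only if $x - y$ is a unit of $R$, and let $\overline{G_R}$ be its complement. The energy $E(\Gamma)$ of a finite graph $\Gamma$ is the sum of the absolute values of the eigenvalues of its adjacency matrix, counted with multiplicity. Then $$E(G_R) = E(\overline{G_R})$$ (that is, $G_R$ is equienergetic with its complement) if and only if $R \cong \mathbb{F}_{q_1} \times \mathbb{F}_{q_2}$ is a product of two finite fields. -/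

import Mathlib

universe u v

/-- The unitary Cayley graph `G_R = X(R, R*)` of a commutative ring `R`: the vertices are the
elements of `R`, and two distinct vertices are adjacent if and only if their difference is a unit. -/
def unitaryCayleyGraph (R : Type u) [CommRing R] : SimpleGraph R :=
  SimpleGraph.addCayley {x : R | IsUnit x}

open scoped Classical in
/-- The energy of a finite graph: the sum of the absolute values of the eigenvalues of its
(real symmetric) adjacency matrix, counted with multiplicity. -/
noncomputable def SimpleGraph.energy {V : Type u} [Fintype V] (G : SimpleGraph V) : ℝ :=
  ∑ i : V, |(G.isHermitian_adjMatrix ℝ).eigenvalues i|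

/-- Two finite graphs with the same number of vertices are equienergetic if their energies agree. -/
def SimpleGraph.Equienergetic {V : Type u} {W : Type v} [Fintype V] [Fintype W]
    (G : SimpleGraph V) (H : SimpleGraph W) : Prop :=
  Fintype.card V = Fintype.card W ∧ G.energy = H.energy

/-! For a local factor with maximal ideal of size `m` and residue field of size `q`, the
unit-difference matrix is all-ones minus the coset matrix of the maximal ideal; its eigenvalues are
`m(q-1)`, `-m`, `0` with multiplicities `1`, `q-1`, `mq-q`. The adjacency matrix of `G_R` is the
Kronecker product of these, and tensor products of the local projections also diagonalise the
complement. Eigenvalues are `0` or at least `1` in absolute value, so both energies become sums of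
products over the factors (`energy_unitaryCayleyGraph`).

With `M = ∏ m`, `X = ∏ q`, `Y = ∏ (q-1)`, `Z = ∏ (q-2)` and `s` even, the energy difference is
`2(M-1)(X-Y) + (X-2Y+Z) - 2`. Since `X-Y ≥ s` and `X-2Y+Z ≥ 2(s-1)`, with `X-2Y+Z = 2` for `s = 2`,
it vanishes exactly when `s = 2` and `M = 1`, that is, for two fields. -/

/-- If the columns of matrices `P c` with `∑ c, P c = 1` are eigenvectors of a Hermitian matrix `A`
for `l c`, then the spectral sums of `A` are computed by the traces of the `P c`. -/
theorem Matrix.IsHermitian.sum_eigenvalues_eq_sum_trace {n ι : Type*} [Fintype n] [DecidableEq n]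
    [Fintype ι] {A : Matrix n n ℝ} (hA : A.IsHermitian) (P : ι → Matrix n n ℝ) (l : ι → ℝ)
    (hP : ∑ c, P c = 1) (hAP : ∀ c, A * P c = l c • P c) (f : ℝ → ℝ) :
    ∑ i, f (hA.eigenvalues i) = ∑ c, f (l c) * (P c).trace := by
  set U : Matrix n n ℝ := (hA.eigenvectorUnitary : Matrix n n ℝ) with hU
  have hUU : star U * U = 1 := Unitary.coe_star_mul_self _
  have hUU' : U * star U = 1 := Unitary.coe_mul_star_self _
  have hD : star U * A * U = Matrix.diagonal hA.eigenvalues := by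
    simpa [Function.comp_def] using! hA.conjStarAlgAut_star_eigenvectorUnitary
  -- In the eigenbasis the diagonal entries `Q c i i` are weights summing to 1 over `c`, and a
  -- nonzero weight forces the `i`-th eigenvalue to be `l c`. Neither idempotence nor orthogonality
  -- of the `P c` is needed.
  set Q : ι → Matrix n n ℝ := fun c => star U * P c * U with hQ
  have hDQ : ∀ c, Matrix.diagonal hA.eigenvalues * Q c = l c • Q c := by
    intro c
    calc Matrix.diagonal hA.eigenvalues * Q c
        = star U * A * (U * star U) * P c * U := by rw [← hD]; simp only [hQ, mul_assoc]
      _ = star U * (A * P c) * U := by rw [hUU']; simp only [mul_assoc, mul_one]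
      _ = l c • Q c := by rw [hAP]; simp [hQ]
  have htr : ∀ c, (P c).trace = ∑ i, Q c i i := by
    intro c
    change _ = (Q c).trace
    rw [hQ]
    simp only
    rw [Matrix.trace_mul_comm, ← mul_assoc, hUU', one_mul]
  have hsum : ∀ i, ∑ c, Q c i i = 1 := by
    intro i
    have : ∑ c, Q c = 1 := by
      simp only [hQ]
      rw [← Finset.sum_mul, ← Finset.mul_sum, hP, mul_one, hUU]
    have h := congrFun (congrFun this i) i
    simpa [Matrix.sum_apply] using h
  have hf : ∀ c i, f (hA.eigenvalues i) * Q c i i = f (l c) * Q c i i := by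
    intro c i
    have h := congrFun (congrFun (hDQ c) i) i
    rw [Matrix.diagonal_mul, Matrix.smul_apply, smul_eq_mul] at h
    by_cases h0 : Q c i i = 0
    · simp [h0]
    · rw [mul_right_cancel₀ h0 h]
  calc ∑ i, f (hA.eigenvalues i) = ∑ i, ∑ c, f (hA.eigenvalues i) * Q c i i := by
        simp_rw [← Finset.mul_sum, hsum, mul_one]
    _ = ∑ c, ∑ i, f (l c) * Q c i i := by
        rw [Finset.sum_comm]; simp_rw [hf]
    _ = _ := by simp_rw [htr, Finset.mul_sum]

/-! ### Kronecker products and the spectrum of a local factor -/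

namespace Matrix

variable {R ι : Type*} {A : ι → Type*} [Fintype ι]

/-- The Kronecker product of a finite family of matrices, indexed through `e : R ≃ ∀ i, A i`. -/
def piKronecker (e : R ≃ ∀ i, A i) (M : ∀ i, Matrix (A i) (A i) ℝ) : Matrix R R ℝ :=
  Matrix.of fun x y => ∏ i, M i (e x i) (e y i)

variable (e : R ≃ ∀ i, A i)

theorem piKronecker_mul [Fintype R] [∀ i, Fintype (A i)] (M N : ∀ i, Matrix (A i) (A i) ℝ) :
    piKronecker e M * piKronecker e N = piKronecker e fun i => M i * N i := by
  classical
  ext x z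
  simp only [piKronecker, Matrix.mul_apply, Matrix.of_apply, ← Finset.prod_mul_distrib]
  rw [e.sum_comp fun y => ∏ i, M i (e x i) (y i) * N i (y i) (e z i), Finset.prod_univ_sum]
  simp

theorem piKronecker_smul (c : ι → ℝ) (M : ∀ i, Matrix (A i) (A i) ℝ) :
    (piKronecker e fun i => c i • M i) = (∏ i, c i) • piKronecker e M := by
  ext x z
  simp [piKronecker, Finset.prod_mul_distrib]

theorem trace_piKronecker [Fintype R] [∀ i, Fintype (A i)] (M : ∀ i, Matrix (A i) (A i) ℝ) :
    (piKronecker e M).trace = ∏ i, (M i).trace := by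
  classical
  simp only [piKronecker, Matrix.trace, Matrix.diag_apply, Matrix.of_apply]
  rw [e.sum_comp fun y => ∏ i, M i (y i) (y i), Finset.prod_univ_sum]
  simp

theorem piKronecker_one [DecidableEq R] [∀ i, DecidableEq (A i)] :
    piKronecker e (fun _ => 1) = 1 := by
  ext x y
  have h : (∀ i, e x i = e y i) ↔ x = y := by rw [← funext_iff, e.injective.eq_iff]
  simp only [piKronecker, Matrix.of_apply, Matrix.one_apply, Finset.prod_ite_zero,
    Finset.prod_const_one, Finset.mem_univ, true_imp_iff, h]

theorem sum_piKronecker [DecidableEq ι] {κ : Type*} [Fintype κ]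
    (P : ∀ i, κ → Matrix (A i) (A i) ℝ) :
    ∑ c : ι → κ, piKronecker e (fun i => P i (c i)) = piKronecker e fun i => ∑ k, P i k := by
  ext x y
  simp only [piKronecker, Matrix.of_apply, Matrix.sum_apply]
  rw [Finset.prod_univ_sum]
  simp

end Matrix

-- The three matrices are the projection onto constants, its complement in the functions constant on
-- cosets of the maximal ideal, and the projection killing the latter. They diagonalise the all-ones
-- matrix too, as the complement graph requires; the traces are the multiplicities.
open scoped Classical in
theorem IsLocalRing.exists_unit_matrix_decomposition (L : Type*) [CommRing L] [IsLocalRing L]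
    [Fintype L] :
    ∃ P : Fin 3 → Matrix L L ℝ, ∑ c, P c = 1 ∧
      (∀ c, (Matrix.of fun x y : L => if IsUnit (x - y) then (1 : ℝ) else 0) * P c =
        (![(Nat.card (maximalIdeal L) : ℝ) * (Nat.card (ResidueField L) - 1),
          -(Nat.card (maximalIdeal L) : ℝ), 0] : Fin 3 → ℝ) c • P c) ∧
      (∀ c, (Matrix.of fun _ _ : L => (1 : ℝ)) * P c =
        (if c = 0 then (Nat.card L : ℝ) else 0) • P c) ∧
      ∀ c, (P c).trace = (![1, (Nat.card (ResidueField L) : ℝ) - 1,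
          Nat.card L - Nat.card (ResidueField L)] : Fin 3 → ℝ) c := by
  set m : ℝ := (Nat.card (maximalIdeal L) : ℝ) with hm
  set q : ℝ := (Nat.card (ResidueField L) : ℝ) with hq
  set n : ℝ := (Nat.card L : ℝ) with hn
  have hnmq : n = m * q := by
    rw [hn, hm, hq, ← Nat.cast_mul, Submodule.card_eq_card_quotient_mul_card (maximalIdeal L)]
    rfl
  have hm0 : m ≠ 0 := by rw [hm]; exact_mod_cast Nat.card_pos.ne'
  have hn0 : n ≠ 0 := by rw [hn]; exact_mod_cast Nat.card_pos.ne'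
  set J : Matrix L L ℝ := Matrix.of fun _ _ => 1 with hJ
  set B : Matrix L L ℝ := Matrix.of fun x y => if x - y ∈ maximalIdeal L then 1 else 0 with hB
  have hA : (Matrix.of fun x y : L => if IsUnit (x - y) then (1 : ℝ) else 0) = J - B := by
    ext x y
    by_cases h : IsUnit (x - y) <;> simp [hJ, hB, h]
  have hcard : ∀ x : L, ∑ y : L, (if x - y ∈ maximalIdeal L then (1 : ℝ) else 0) = m := by
    intro x
    have h := (Equiv.subLeft x).sum_comp (fun y => if y ∈ maximalIdeal L then (1 : ℝ) else 0)
    simp only [Equiv.subLeft_apply] at h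
    rw [h, Finset.sum_boole, hm, Nat.card_eq_fintype_card, Fintype.card_subtype]
  have hJJ : J * J = n • J := by
    ext x y; simp [hJ, Matrix.mul_apply, hn]
  have hBJ : B * J = m • J := by
    ext x y; simp only [hB, hJ, Matrix.mul_apply, Matrix.of_apply, mul_one, hcard,
      Matrix.smul_apply, smul_eq_mul]
  have hJB : J * B = m • J := by
    ext x y
    simp only [hB, hJ, Matrix.mul_apply, Matrix.of_apply, mul_one, one_mul,
      Matrix.smul_apply, smul_eq_mul]
    rw [← hcard y]
    refine Finset.sum_congr rfl fun z _ => ?_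
    rw [← neg_sub, neg_mem_iff]
  have hBB : B * B = m • B := by
    ext x z
    simp only [hB, Matrix.mul_apply, Matrix.of_apply, Matrix.smul_apply, smul_eq_mul]
    rw [← hcard x, Finset.sum_mul]
    refine Finset.sum_congr rfl fun y _ => ?_
    by_cases h : x - y ∈ maximalIdeal L
    · have : x - z ∈ maximalIdeal L ↔ y - z ∈ maximalIdeal L := by
        rw [← sub_add_sub_cancel x y z]; exact Ideal.add_mem_iff_right _ h
      simp only [this]
    · simp [h]
  have htJ : J.trace = n := by simp [Matrix.trace, hJ, hn]
  have htB : B.trace = n := by simp [Matrix.trace, hB, hn]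
  have htI : (1 : Matrix L L ℝ).trace = n := by simp [hn]
  refine ⟨![n⁻¹ • J, m⁻¹ • B - n⁻¹ • J, 1 - m⁻¹ • B], ?_, ?_, ?_, ?_⟩
  · simp [Fin.sum_univ_three]
  · rw [hA]
    intro c
    fin_cases c
    · simp [sub_mul, hJJ, hBJ, ← sub_smul, smul_smul, hnmq]
      congr 1; ring
    · simp [mul_sub, sub_mul, hJJ, hBJ, hJB, hBB, smul_sub, smul_smul, hm0, hn0]
      rw [mul_comm n⁻¹ m]; abel
    · simp [mul_sub, sub_mul, hJB, hBB, smul_sub, smul_smul, hm0]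
  · intro c
    fin_cases c
    · simp [hJJ, smul_smul, mul_comm]
    · simp [mul_sub, hJJ, hJB, smul_smul, hm0, hn0]
    · simp [mul_sub, hJB, smul_smul, hm0]
  · intro c
    fin_cases c
    · simp [htJ, hn0]
    · simp [htJ, htB, hn0]
      rw [hnmq]; field_simp
    · simp [htB, htI]
      rw [hnmq]; field_simp

/-! ### Energies of the graph and its complement -/

theorem isUnit_iff_forall_isUnit_apply {R ι : Type*} [CommRing R] {A : ι → Type*}
    [∀ i, CommRing (A i)] (e : R ≃+* ∀ i, A i) (x : R) : IsUnit x ↔ ∀ i, IsUnit (e x i) := by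
  rw [← Pi.isUnit_iff]
  exact (isUnit_map_iff e x).symm

theorem unitaryCayleyGraph_adj {R : Type*} [CommRing R] [Nontrivial R] (x y : R) :
    (unitaryCayleyGraph R).Adj x y ↔ IsUnit (x - y) := by
  rw [unitaryCayleyGraph, SimpleGraph.addCayley_adj']
  constructor
  · rintro ⟨-, g, hg, rfl | rfl⟩
    · simpa using! hg
    · simpa using! hg
  · intro h
    refine ⟨?_, x - y, h, Or.inr (by ring)⟩
    rintro rfl
    simp at h

/-- Every term on the right is multiplicative in `x` up to sign, so its sum over products of local
eigenvalues factors. -/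
theorem abs_neg_one_sub_of_one_le_abs {x : ℝ} (hx : x = 0 ∨ 1 ≤ |x|) :
    |-1 - x| = |x| + SignType.sign x + (1 - |(SignType.sign x : ℝ)|) := by
  rcases hx with rfl | hx
  · simp
  · rcases lt_trichotomy x 0 with h | rfl | h
    · rw [abs_of_neg h] at hx ⊢
      rw [sign_neg h, abs_of_nonneg (by linarith)]
      simp; ring
    · norm_num at hx
    · rw [abs_of_pos h] at hx ⊢
      rw [sign_pos h, abs_of_nonpos (by linarith)]
      simp

open IsLocalRing in
/-- The energies of the unitary Cayley graph and of its complement, in terms of the sizes of the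
maximal ideals and residue fields of the local factors. -/
theorem energy_unitaryCayleyGraph {R ι : Type*} [CommRing R] [Fintype R] [Fintype ι] [Nonempty ι]
    {A : ι → Type*} [∀ i, CommRing (A i)] [∀ i, IsLocalRing (A i)] [∀ i, Finite (A i)]
    (e : R ≃+* ∀ i, A i) (m q : ι → ℝ) (hm : ∀ i, m i = Nat.card (maximalIdeal (A i)))
    (hq : ∀ i, q i = Nat.card (ResidueField (A i))) :
    (unitaryCayleyGraph R).energy = ∏ i, (2 * (m i * (q i - 1))) ∧
    (unitaryCayleyGraph R)ᶜ.energy = ∏ i, (2 * (m i * (q i - 1))) + ∏ i, (2 - q i)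
      + 2 * ∏ i, (m i * q i) - ∏ i, q i - 2 - 2 * ∏ i, (m i * (q i - 1)) := by
  classical
  have : ∀ i, Fintype (A i) := fun i => Fintype.ofFinite _
  have i₀ : ι := Classical.arbitrary ι
  have : Nontrivial (∀ i, A i) := Pi.nontrivial_at i₀
  have : ∀ i, Finite (ResidueField (A i)) := fun i => Finite.of_surjective _ residue_surjective
  have : Nontrivial R := (e : R ≃ ∀ i, A i).nontrivial
  choose P hP1 hPA hPJ hPt using fun i => exists_unit_matrix_decomposition (A i)
  simp only [← hm, ← hq] at hPA hPt
  have hm1 : ∀ i, 1 ≤ m i := fun i => by rw [hm]; exact_mod_cast Nat.card_pos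
  have hq2 : ∀ i, 2 ≤ q i := fun i => by rw [hq]; exact_mod_cast Finite.one_lt_card
  have hmq : ∀ i, (Nat.card (A i) : ℝ) = m i * q i := fun i => by
    rw [Submodule.card_eq_card_quotient_mul_card (maximalIdeal (A i)), hm, hq, Nat.cast_mul]; rfl
  set l : ι → Fin 3 → ℝ := fun i => ![m i * (q i - 1), -m i, 0] with hl
  set t : ι → Fin 3 → ℝ := fun i => ![1, q i - 1, m i * q i - q i] with ht
  set Q : (ι → Fin 3) → Matrix R R ℝ := fun c => Matrix.piKronecker e fun i => P i (c i) with hQ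
  have hQ1 : ∑ c, Q c = 1 := by
    simp only [hQ]
    rw [Matrix.sum_piKronecker (e : R ≃ ∀ i, A i) P]
    simp only [hP1]
    exact Matrix.piKronecker_one (e : R ≃ ∀ i, A i)
  have hQt : ∀ c, (Q c).trace = ∏ i, t i (c i) := by
    intro c
    simp only [hQ]
    rw [Matrix.trace_piKronecker (e : R ≃ ∀ i, A i)]
    simp only [hPt, hmq, ht]
  have hQA : ∀ c, (unitaryCayleyGraph R).adjMatrix ℝ * Q c = (∏ i, l i (c i)) • Q c := by
    intro c
    have : (unitaryCayleyGraph R).adjMatrix ℝ = Matrix.piKronecker e fun i =>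
        Matrix.of fun x y : A i => if IsUnit (x - y) then (1 : ℝ) else 0 := by
      ext x y
      simp [Matrix.piKronecker, SimpleGraph.adjMatrix_apply, unitaryCayleyGraph_adj,
        isUnit_iff_forall_isUnit_apply e, Finset.prod_ite_zero]
    simp only [hQ]
    rw [this, Matrix.piKronecker_mul (e : R ≃ ∀ i, A i)]
    simp only [hPA]
    rw [Matrix.piKronecker_smul (e : R ≃ ∀ i, A i)]
  have hQJ : ∀ c, (Matrix.of fun _ _ : R => (1 : ℝ)) * Q c =
      (∏ i, if c i = 0 then m i * q i else 0) • Q c := by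
    intro c
    have : (Matrix.of fun _ _ : R => (1 : ℝ)) = Matrix.piKronecker e fun i =>
        Matrix.of fun _ _ : A i => (1 : ℝ) := by
      ext x y
      simp [Matrix.piKronecker]
    simp only [hQ]
    rw [this, Matrix.piKronecker_mul (e : R ≃ ∀ i, A i)]
    simp only [hPJ, hmq]
    rw [Matrix.piKronecker_smul (e : R ≃ ∀ i, A i)]
  have hQA' : ∀ c, (unitaryCayleyGraph R)ᶜ.adjMatrix ℝ * Q c =
      ((∏ i, if c i = 0 then m i * q i else 0) - 1 - ∏ i, l i (c i)) • Q c := by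
    intro c
    have : (unitaryCayleyGraph R)ᶜ.adjMatrix ℝ =
        (Matrix.of fun _ _ : R => (1 : ℝ)) - 1 - (unitaryCayleyGraph R).adjMatrix ℝ := by
      ext x y
      by_cases hxy : x = y
      · simp [hxy]
      · by_cases h : (unitaryCayleyGraph R).Adj x y <;>
          simp [SimpleGraph.adjMatrix_apply, hxy, h]
    rw [this, sub_mul, sub_mul, hQA, hQJ, one_mul, sub_smul, sub_smul, one_smul]
  have hprod : ∀ g : ι → Fin 3 → ℝ, ∑ c : ι → Fin 3, ∏ i, g i (c i) = ∏ i, ∑ k, g i k := by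
    intro g
    rw [Finset.prod_univ_sum]
    simp
  have hl' : ∀ c : ι → Fin 3, ∏ i, l i (c i) = 0 ∨ 1 ≤ |∏ i, l i (c i)| := by
    intro c
    by_cases h : ∃ i, c i = 2
    · obtain ⟨i, hi⟩ := h
      exact Or.inl (Finset.prod_eq_zero (Finset.mem_univ i) (by simp [hi, hl]))
    · push Not at h
      right
      rw [Finset.abs_prod]
      refine Finset.one_le_prod fun i _ => ?_
      have h3 : c i = 0 ∨ c i = 1 := by have := h i; omega
      rcases h3 with h3 | h3
      · simp only [h3, hl, Matrix.cons_val_zero]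
        refine le_trans ?_ (le_abs_self _)
        nlinarith [hm1 i, hq2 i]
      · simp only [h3, hl, Matrix.cons_val_one, Matrix.cons_val_zero, abs_neg]
        exact (hm1 i).trans (le_abs_self _)
  have hS0 : ∑ c : ι → Fin 3, |∏ i, l i (c i)| * ∏ i, t i (c i) =
      ∏ i, (2 * (m i * (q i - 1))) := by
    simp only [Finset.abs_prod, ← Finset.prod_mul_distrib]
    rw [hprod fun i k => |l i k| * t i k]
    refine Finset.prod_congr rfl fun i _ => ?_
    have h1 := hm1 i
    have h2 := hq2 i
    have h3 : 0 ≤ m i * (q i - 1) := by nlinarith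
    simp [Fin.sum_univ_three, hl, ht]
    rw [abs_of_nonneg (by linarith : 0 ≤ m i), abs_of_nonneg (by linarith : 0 ≤ q i - 1)]
    ring
  refine ⟨?_, ?_⟩
  · rw [SimpleGraph.energy,
      Matrix.IsHermitian.sum_eigenvalues_eq_sum_trace _ Q _ hQ1 hQA (fun x => |x|)]
    simp only [hQt]
    exact hS0
  · rw [SimpleGraph.energy,
      Matrix.IsHermitian.sum_eigenvalues_eq_sum_trace _ Q _ hQ1 (fun c => by convert hQA' c <;> rfl) (fun x => |x|)]
    simp only [hQt]
    have hsign : ∀ i, SignType.sign (m i) = 1 ∧ SignType.sign (m i * (q i - 1)) = 1 := by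
      intro i
      have h1 := hm1 i
      have h2 := hq2 i
      exact ⟨sign_pos (by linarith), sign_pos (by nlinarith)⟩
    have hsp : ∀ c : ι → Fin 3, (SignType.sign (∏ i, l i (c i)) : ℝ) =
        ∏ i, (SignType.sign (l i (c i)) : ℝ) := fun c => by
      have h : SignType.sign (∏ i, l i (c i)) = ∏ i, SignType.sign (l i (c i)) :=
        map_prod (signHom : ℝ →*₀ SignType) _ _
      rw [h]
      exact map_prod (SignType.castHom : SignType →*₀ ℝ) _ _
    have hS1 : ∑ c : ι → Fin 3, (SignType.sign (∏ i, l i (c i)) : ℝ) * ∏ i, t i (c i) =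
        ∏ i, (2 - q i) := by
      simp only [hsp, ← Finset.prod_mul_distrib]
      rw [hprod fun i k => (SignType.sign (l i k) : ℝ) * t i k]
      refine Finset.prod_congr rfl fun i _ => ?_
      simp [Fin.sum_univ_three, hl, ht, (hsign i).1, (hsign i).2, Left.sign_neg]
      ring
    have hS2 : ∑ c : ι → Fin 3, |(SignType.sign (∏ i, l i (c i)) : ℝ)| * ∏ i, t i (c i) =
        ∏ i, q i := by
      simp only [hsp, Finset.abs_prod, ← Finset.prod_mul_distrib]
      rw [hprod fun i k => |(SignType.sign (l i k) : ℝ)| * t i k]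
      refine Finset.prod_congr rfl fun i _ => ?_
      simp [Fin.sum_univ_three, hl, ht, (hsign i).1, (hsign i).2, Left.sign_neg]
    have hS3 : ∑ c : ι → Fin 3, ∏ i, t i (c i) = ∏ i, (m i * q i) := by
      rw [hprod]
      refine Finset.prod_congr rfl fun i _ => ?_
      simp [Fin.sum_univ_three, ht]
    -- This makes the complement's eigenvalue on constants nonnegative. Over `ℕ` the strict
    -- inequality supplies the `+ 1`.
    have hlt : ∏ i, (m i * (q i - 1)) + 1 ≤ ∏ i, (m i * q i) := by
      have h : ∏ i, (Nat.card (maximalIdeal (A i)) * (Nat.card (ResidueField (A i)) - 1)) <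
          ∏ i, (Nat.card (maximalIdeal (A i)) * Nat.card (ResidueField (A i))) := by
        have h1 : ∀ i, 1 < Nat.card (ResidueField (A i)) := fun i => Finite.one_lt_card
        have h2 : ∀ i, 0 < Nat.card (maximalIdeal (A i)) := fun i => Nat.card_pos
        refine Finset.prod_lt_prod_of_nonempty (fun i _ => ?_) (fun i _ => ?_)
          Finset.univ_nonempty
        · exact Nat.mul_pos (h2 i) (Nat.sub_pos_of_lt (h1 i))
        · exact Nat.mul_lt_mul_of_pos_left (Nat.sub_lt (by have := h1 i; omega) one_pos) (h2 i)
      have h' : ((∏ i, (Nat.card (maximalIdeal (A i)) * (Nat.card (ResidueField (A i)) - 1))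
          + 1 : ℕ) : ℝ) ≤ ((∏ i, (Nat.card (maximalIdeal (A i)) *
            Nat.card (ResidueField (A i))) : ℕ) : ℝ) := by exact_mod_cast h
      have h3 : ∀ i, ((Nat.card (ResidueField (A i)) - 1 : ℕ) : ℝ) = q i - 1 := fun i => by
        rw [hq, Nat.cast_pred Nat.card_pos]
      push_cast [h3] at h'
      simpa only [← hm, ← hq] using h'
    -- The all-ones matrix contributes only at `c = 0`; there the true value `n-1-λ` replaces `λ+1`,
    -- whence the correction `n-2-2λ`.
    have hterm : ∀ c : ι → Fin 3,
        |(∏ i, if c i = 0 then m i * q i else 0) - 1 - ∏ i, l i (c i)| * ∏ i, t i (c i) =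
        |∏ i, l i (c i)| * ∏ i, t i (c i)
          + (SignType.sign (∏ i, l i (c i)) : ℝ) * ∏ i, t i (c i)
          + ∏ i, t i (c i) - |(SignType.sign (∏ i, l i (c i)) : ℝ)| * ∏ i, t i (c i)
          + if c = 0 then ∏ i, (m i * q i) - 2 - 2 * ∏ i, (m i * (q i - 1)) else 0 := by
      intro c
      have key := abs_neg_one_sub_of_one_le_abs (hl' c)
      by_cases hc : c = 0
      · subst hc
        simp [hl, ht] at key ⊢
        have h0 : 0 < ∏ i, (m i * (q i - 1)) :=
          Finset.prod_pos fun i _ => by nlinarith [hm1 i, hq2 i]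
        simp only [Finset.prod_mul_distrib] at hlt h0 ⊢
        rw [abs_of_nonneg (by linarith)]
        simp [sign_pos h0, abs_of_pos h0]
        ring
      · obtain ⟨i, hi⟩ : ∃ i, c i ≠ 0 := by
          by_contra! h
          exact hc (funext h)
        rw [Finset.prod_eq_zero (f := fun i => if c i = 0 then m i * q i else 0)
          (Finset.mem_univ i) (by simp [hi]), zero_sub, key]
        simp [hc]
        ring
    rw [Finset.sum_congr rfl fun c _ => hterm c]
    simp only [Finset.sum_add_distrib, Finset.sum_sub_distrib, hS0, hS1, hS2, hS3,
      Finset.sum_ite_eq', Finset.mem_univ, if_true]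
    ring

/-! ### When the two energies agree -/

theorem IsLocalRing.isField_iff_card_maximalIdeal_eq_one {L : Type*} [CommRing L] [IsLocalRing L] :
    IsField L ↔ Nat.card (maximalIdeal L) = 1 := by
  rw [isField_iff_maximalIdeal_eq]
  rw [← Submodule.toAddSubgroup_inj]
  exact AddSubgroup.card_eq_one.symm

/-- With `x`, `y`, `z` the three products over `S`, a new factor `q` turns `x-y` into `x +
(q-1)(x-y)` and `x-2y+z` into `(q-2)(x-2y+z) + 2(x-y)`. -/
theorem prod_sub_prod_sub_one_bounds {ι : Type*} [DecidableEq ι] (q : ι → ℝ) (hq : ∀ i, 2 ≤ q i)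
    (S : Finset ι) :
    1 ≤ ∏ i ∈ S, q i ∧ (S.card : ℝ) ≤ ∏ i ∈ S, q i - ∏ i ∈ S, (q i - 1) ∧
      0 ≤ ∏ i ∈ S, q i - 2 * ∏ i ∈ S, (q i - 1) + ∏ i ∈ S, (q i - 2) ∧
      2 * ((S.card : ℝ) - 1) ≤
        ∏ i ∈ S, q i - 2 * ∏ i ∈ S, (q i - 1) + ∏ i ∈ S, (q i - 2) := by
  induction S using Finset.induction_on with
  | empty => norm_num
  | insert a S ha ih =>
    obtain ⟨h1, h2, h3, -⟩ := ih
    have hc : (0 : ℝ) ≤ S.card := Nat.cast_nonneg _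
    have hqa := hq a
    simp only [Finset.prod_insert ha, Finset.card_insert_of_notMem ha, Nat.cast_add, Nat.cast_one]
    set x := ∏ i ∈ S, q i
    set y := ∏ i ∈ S, (q i - 1)
    set z := ∏ i ∈ S, (q i - 2)
    have h4 := mul_nonneg (sub_nonneg.2 hqa) h3
    have h5 := mul_nonneg (sub_nonneg.2 hqa) (hc.trans h2)
    refine ⟨by nlinarith, by nlinarith, by nlinarith, by nlinarith⟩

/-- For an even number `s` of factors, the difference of the two energies vanishes if and only if
`s = 2` and the factors `m i` are trivial. -/
theorem energy_difference_eq_zero_iff {s : ℕ} (hs : 0 < s) (hs_even : Even s) (m q : Fin s → ℝ)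
    (hm : ∀ i, 1 ≤ m i) (hq : ∀ i, 2 ≤ q i) :
    ∏ i, (2 - q i) + 2 * ∏ i, (m i * q i) - ∏ i, q i - 2 - 2 * ∏ i, (m i * (q i - 1)) = 0 ↔
      s = 2 ∧ ∀ i, m i = 1 := by
  obtain ⟨-, h2, -, h4⟩ := prod_sub_prod_sub_one_bounds q hq Finset.univ
  have hneg : ∏ i, (2 - q i) = ∏ i, (q i - 2) := by
    have h := Finset.prod_neg (s := Finset.univ) (f := fun i => q i - 2)
    simpa [hs_even.neg_one_pow] using h
  have hM : 1 ≤ ∏ i, m i := Finset.one_le_prod fun i _ => hm i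
  rw [Finset.card_univ, Fintype.card_fin] at h2 h4
  constructor
  · intro h
    rw [hneg, Finset.prod_mul_distrib, Finset.prod_mul_distrib] at h
    have hs0 : (0 : ℝ) ≤ s := Nat.cast_nonneg _
    have hprod := mul_nonneg (sub_nonneg.2 hM) (hs0.trans h2)
    have hs2 : s = 2 := by
      by_contra hne
      have h4' : 4 ≤ s := by obtain ⟨k, rfl⟩ := hs_even; omega
      have : (4 : ℝ) ≤ s := by exact_mod_cast h4'
      nlinarith
    subst hs2
    refine ⟨rfl, ?_⟩
    simp only [Fin.prod_univ_two] at h hM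
    have hm0 := hm 0
    have hm1 := hm 1
    have hM1 : m 0 * m 1 = 1 := by
      have hpos : 0 < q 0 + q 1 - 1 := by linarith [hq 0, hq 1]
      have : (m 0 * m 1 - 1) * (q 0 + q 1 - 1) = 0 := by linear_combination h / 2
      rcases mul_eq_zero.1 this with h | h <;> linarith
    rw [Fin.forall_fin_two]
    constructor <;> nlinarith
  · rintro ⟨rfl, h⟩
    simp only [Fin.prod_univ_two, h]
    ring

open IsLocalRing in
theorem unitaryCayleyGraph_equienergetic_compl_iff {R : Type*} [CommRing R] [Fintype R]
    {s : ℕ} (hs : 0 < s) (hs_even : Even s) {A : Fin s → Type*} [∀ i, CommRing (A i)]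
    [∀ i, IsLocalRing (A i)] (e : R ≃+* ∀ i, A i) :
    (unitaryCayleyGraph R).Equienergetic (unitaryCayleyGraph R)ᶜ ↔ s = 2 ∧ ∀ i, IsField (A i) := by
  have : Nonempty (Fin s) := ⟨⟨0, hs⟩⟩
  have : ∀ i, Finite (A i) := fun i => Finite.of_surjective (fun x : R => e x i)
    ((Function.surjective_eval i).comp e.surjective)
  have : ∀ i, Finite (ResidueField (A i)) := fun i => Finite.of_surjective _ residue_surjective
  obtain ⟨h1, h2⟩ := energy_unitaryCayleyGraph e (fun i => (Nat.card (maximalIdeal (A i)) : ℝ))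
    (fun i => (Nat.card (ResidueField (A i)) : ℝ)) (fun _ => rfl) (fun _ => rfl)
  have key := energy_difference_eq_zero_iff hs hs_even
    (fun i => (Nat.card (maximalIdeal (A i)) : ℝ)) (fun i => (Nat.card (ResidueField (A i)) : ℝ))
    (fun i => by exact_mod_cast Nat.card_pos) (fun i => by exact_mod_cast Finite.one_lt_card)
  simp only [Nat.cast_eq_one] at key
  simp only [isField_iff_card_maximalIdeal_eq_one, ← key]
  rw [SimpleGraph.Equienergetic, h1, h2]
  constructor
  · rintro ⟨-, h⟩
    linarith
  · intro h
    exact ⟨rfl, by linarith⟩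

theorem mainTheorem8 (R : Type u) [CommRing R] [Fintype R]
    (s : ℕ) (hs : 0 < s) (hs_even : Even s)
    (A : Fin s → Type v) [∀ i, CommRing (A i)] [∀ i, IsLocalRing (A i)]
    (e : R ≃+* ∀ i, A i) :
    (unitaryCayleyGraph R).Equienergetic (unitaryCayleyGraph R)ᶜ ↔
      ∃ (F₁ F₂ : Type u) (_ : Field F₁) (_ : Field F₂) (_ : Finite F₁) (_ : Finite F₂),
        Nonempty (R ≃+* F₁ × F₂) := by
  constructor
  · intro h
    obtain ⟨rfl, hF⟩ := (unitaryCayleyGraph_equienergetic_compl_iff hs hs_even e).1 h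
    -- Each `A i` is replaced by an isomorphic quotient of `R`, to land in the universe of `R`.
    set φ : ∀ i, R →+* A i := fun i => (Pi.evalRingHom A i).comp e.toRingHom
    have hφ : ∀ i, Function.Surjective (φ i) := fun i =>
      (Function.surjective_eval i).comp e.surjective
    let ψ : ∀ i, R ⧸ RingHom.ker (φ i) ≃+* A i := fun i =>
      RingHom.quotientKerEquivOfSurjective (hφ i)
    have hK : ∀ i, IsField (R ⧸ RingHom.ker (φ i)) := fun i => (ψ i).toMulEquiv.isField (hF i)
    exact ⟨_, _, (hK 0).toField, (hK 1).toField, inferInstance, inferInstance,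
      ⟨(e.trans (RingEquiv.piFinTwo A)).trans (RingEquiv.prodCongr (ψ 0).symm (ψ 1).symm)⟩⟩
  -- The criterion is applied to the decomposition `F₁ × F₂` itself, so uniqueness of the Artin
  -- decomposition is not needed.
  · rintro ⟨F₁, F₂, _, _, _, _, ⟨f⟩⟩
    let : ∀ i, Field ((![F₁, F₂] : Fin 2 → Type u) i) :=
      Fin.cons ‹Field F₁› (Fin.cons ‹Field F₂› finZeroElim)
    exact (unitaryCayleyGraph_equienergetic_compl_iff two_pos even_two
      (f.trans (RingEquiv.piFinTwo ![F₁, F₂]).symm)).2 ⟨rfl, fun i => Field.toIsField _⟩
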